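/- Let $n\in\{4,5\}$. A convex body in $\mathbb{R}^n$ is a compact convex set with non-empty interior, and for $\lambda\in(0,1)$ and $A\subset\mathbb{R}^n$ let $D_\lambda A=(1-\lambda)A+\lambda(-A)$ (Minkowski sum). Then for every convex body $K\subset\mathbb{R}^n$, every $\lambda\in(0,1)$ and every $n$-dimensional simplex $\Delta\subset\mathbb{R}^n$ (the convex hull of $n+1$ affinely independent points), $$\frac{\operatorname{vol}(D_\lambda K)}{\operatorname{vol}(K)}\le\frac{\operatorname{vol}(D_\lambda \Delta)}{\operatorname{vol}(\Delta)},$$ where $\operatorname{vol}$ denotes $n$-dimensional Lebesgue measure. -/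

import Mathlib

open MeasureTheory
open scoped Pointwise

/-- The unbalanced difference body `D_t K = (1 - t) K + t (-K)` (Minkowski sum). -/
def unbalancedDifferenceBody {n : ℕ} (t : ℝ) (K : Set (EuclideanSpace ℝ (Fin n))) :
    Set (EuclideanSpace ℝ (Fin n)) :=
  (1 - t) • K + t • (-K)

/-! The volume of `K + t • (-K)` is a polynomial `p` of degree at most `n` in `t ≥ 0` (Minkowski).
Scaling by `-t` exchanges `t` and `1/t`, so `p` is palindromic: for `n = 4, 5` only the coefficients
`a` of `t` and `b` of `t²` remain besides the constant term, the volume of `K`. Two bounds control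
them. A translate of `-K` lies in `n • K`, whence `a ≤ n² vol K`; Rogers–Shephard bounds `p(1)` by
`centralBinom n * vol K`. Rewriting `p` in terms of `a` and `p(1)` gives both nonnegative weights on
`t ≥ 0`, so `p(t) ≤ ∑ (n choose j)² t^j vol K`. Conversely, `s • Δ + t • (-Δ)` contains an affine
image of a cross-simplex whose volume gives that sum, homogenised, as a lower bound for the simplex
ratio.

Polynomiality comes from a transport map. The gradient of the log-Laplace transform of `K`
(`gibbsMean`) is strictly monotone with values in `K`, and `s • gibbsMean μ K + t • gibbsMean μ L`
is injective and covers `s • K + t • L` up to a null set. By change of variables the volume is the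
integral of a determinant polynomial in `t`. -/

/-! ### Log-Laplace transforms of convex bodies and their gradients. -/

section ExponentialFamily

variable {E : Type*} [NormedAddCommGroup E] [InnerProductSpace ℝ E] [MeasurableSpace E]
  [BorelSpace E] {F : Type*} [NormedAddCommGroup F] [NormedSpace ℝ F]

/-- The exponential moment `∫_K e^⟪u, y⟫ f(y) dμ(y)`. -/
noncomputable def expMoment (μ : Measure E) (K : Set E) (f : E → F) (u : E) : F :=
  ∫ y in K, Real.exp (inner ℝ u y) • f y ∂μ

/-- The barycentre of `K` for the measure with density `y ↦ e^⟪u, y⟫`. -/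
noncomputable def gibbsMean (μ : Measure E) (K : Set E) (u : E) : E :=
  (expMoment μ K (fun _ => (1 : ℝ)) u)⁻¹ • expMoment μ K id u

variable {μ : Measure E} {K : Set E}

lemma integrableOn_exp_inner_smul [IsFiniteMeasureOnCompacts μ] (hK : IsCompact K) {f : E → F}
    (hf : Continuous f) (u : E) :
    IntegrableOn (fun y => Real.exp (inner ℝ u y) • f y) K μ := by
  have : Continuous fun y => Real.exp (inner ℝ u y) • f y := by fun_prop
  exact this.continuousOn.integrableOn_compact hK

lemma hasFDerivAt_expMoment [IsFiniteMeasureOnCompacts μ] (hK : IsCompact K) {f : E → F}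
    (hf : Continuous f) (u : E) :
    HasFDerivAt (expMoment μ K f)
      (expMoment μ K (fun y => (innerSL ℝ y).smulRight (f y)) u) u := by
  have hc : Continuous fun y => (innerSL ℝ y).smulRight (f y) := by
    have : Continuous fun y : E => ContinuousLinearMap.smulRightL ℝ E F (innerSL ℝ y) (f y) := by
      fun_prop
    exact this
  obtain ⟨R, hR⟩ := hK.isBounded.exists_norm_le
  refine hasFDerivAt_integral_of_dominated_of_fderiv_le (μ := μ.restrict K)
    (F := fun u y => Real.exp (inner ℝ u y) • f y)
    (F' := fun u y => Real.exp (inner ℝ u y) • (innerSL ℝ y).smulRight (f y))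
    (s := Metric.ball u 1)
    (bound := fun y => Real.exp ((‖u‖ + 1) * R) * ‖(innerSL ℝ y).smulRight (f y)‖)
    (Metric.ball_mem_nhds u one_pos) ?_ ?_ ?_ ?_ ?_ ?_
  · exact .of_forall fun w => (integrableOn_exp_inner_smul hK hf w).aestronglyMeasurable
  · exact integrableOn_exp_inner_smul hK hf u
  · exact (integrableOn_exp_inner_smul hK hc u).aestronglyMeasurable
  · filter_upwards [ae_restrict_mem hK.measurableSet] with y hy w hw
    rw [norm_smul, Real.norm_eq_abs, Real.abs_exp]
    gcongr
    have hw' : ‖w‖ ≤ ‖u‖ + 1 := by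
      have := norm_sub_norm_le w u
      have := mem_ball_iff_norm.1 hw
      linarith
    calc inner ℝ w y ≤ ‖w‖ * ‖y‖ := real_inner_le_norm w y
      _ ≤ (‖u‖ + 1) * R := by gcongr; exact hR y hy
  · have : Continuous fun y => Real.exp ((‖u‖ + 1) * R) * ‖(innerSL ℝ y).smulRight (f y)‖ := by
      fun_prop
    exact this.continuousOn.integrableOn_compact hK
  · refine .of_forall fun y w _ => ?_
    have h1 : HasFDerivAt (fun x : E => inner ℝ x y) (innerSL ℝ y) w := by
      have := (innerSL ℝ y).hasFDerivAt (x := w)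
      refine this.congr_of_eventuallyEq (.of_forall fun x => ?_)
      simp [real_inner_comm]
    refine (h1.exp.smul_const (f y)).congr_fderiv ?_
    ext v
    simp [smul_smul]

lemma expMoment_one_pos [IsFiniteMeasureOnCompacts μ] [μ.IsOpenPosMeasure] (hK : IsCompact K)
    (hi : (interior K).Nonempty) (u : E) : 0 < expMoment μ K (fun _ => (1 : ℝ)) u := by
  have h0 : 0 < μ K := (isOpen_interior.measure_pos μ hi).trans_le (measure_mono interior_subset)
  have := integrableOn_exp_inner_smul (μ := μ) hK (f := fun _ => (1 : ℝ)) continuous_const u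
  refine (integral_pos_iff_support_of_nonneg (fun y => by positivity) this).2 ?_
  have : (Function.support fun y => Real.exp (inner ℝ u y) • (1 : ℝ)) = Set.univ := by
    ext y; simp [(Real.exp_pos _).ne']
  rw [this, Measure.restrict_apply_univ]
  exact h0

lemma differentiable_gibbsMean [IsFiniteMeasureOnCompacts μ] [μ.IsOpenPosMeasure]
    (hK : IsCompact K) (hi : (interior K).Nonempty) : Differentiable ℝ (gibbsMean μ K) := by
  intro u
  refine DifferentiableAt.smul ?_ (hasFDerivAt_expMoment hK continuous_id u).differentiableAt
  exact (hasFDerivAt_expMoment hK continuous_const u).differentiableAt.inv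
    (expMoment_one_pos hK hi u).ne'

lemma inner_expMoment_id [CompleteSpace E] [IsFiniteMeasureOnCompacts μ] (hK : IsCompact K)
    (u v : E) :
    inner ℝ (expMoment μ K id u) v = ∫ y in K, Real.exp (inner ℝ u y) * inner ℝ y v ∂μ := by
  rw [real_inner_comm, expMoment,
    ← integral_inner (integrableOn_exp_inner_smul hK continuous_id u) v]
  refine integral_congr_ae (.of_forall fun y => ?_)
  simp [inner_smul_right, real_inner_comm]

/-- Identifies the Gibbs mean as a gradient, so that its values can be prescribed by minimising a
function. -/
lemma hasFDerivAt_log_expMoment [CompleteSpace E] [IsFiniteMeasureOnCompacts μ]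
    [μ.IsOpenPosMeasure] (hK : IsCompact K) (hi : (interior K).Nonempty) (u : E) :
    HasFDerivAt (fun w => Real.log (expMoment μ K (fun _ => (1 : ℝ)) w))
      (innerSL ℝ (gibbsMean μ K u)) u := by
  refine ((hasFDerivAt_expMoment hK continuous_const u).log
    (expMoment_one_pos hK hi u).ne').congr_fderiv ?_
  ext v
  have hc : Continuous fun y : E => (innerSL ℝ y).smulRight (1 : ℝ) := by
    have : Continuous fun y : E => ContinuousLinearMap.smulRightL ℝ E ℝ (innerSL ℝ y) 1 := by
      fun_prop
    exact this
  have h := ContinuousLinearMap.integral_apply (integrableOn_exp_inner_smul (μ := μ) hK hc u) v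
  simp only [gibbsMean, innerSL_apply_apply, inner_smul_left, inner_expMoment_id hK]
  rw [smul_apply, expMoment, expMoment, h]
  simp

/-- A barycentre of a probability measure carried by a closed convex set stays in the set. -/
lemma gibbsMean_mem [CompleteSpace E] [IsFiniteMeasureOnCompacts μ] [μ.IsOpenPosMeasure]
    (hK : IsCompact K) (hc : Convex ℝ K) (hi : (interior K).Nonempty) (u : E) :
    gibbsMean μ K u ∈ K := by
  have h1 := integrableOn_exp_inner_smul (μ := μ) hK (f := fun _ => (1 : ℝ)) continuous_const u
  simp only [smul_eq_mul, mul_one] at h1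
  have h0 : 0 < μ K := (isOpen_interior.measure_pos μ hi).trans_le (measure_mono interior_subset)
  have : NeZero (μ.restrict K) := ⟨by simpa [Measure.restrict_eq_zero] using h0.ne'⟩
  have := isProbabilityMeasure_tilted h1
  have hZ : ∫ y in K, Real.exp (inner ℝ u y) ∂μ = expMoment μ K (fun _ => (1 : ℝ)) u := by
    simp [expMoment]
  have key : ∫ y, y ∂((μ.restrict K).tilted (inner ℝ u)) = gibbsMean μ K u := by
    rw [integral_tilted, gibbsMean, hZ]
    change _ = _ • ∫ y in K, Real.exp (inner ℝ u y) • id y ∂μ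
    rw [← integral_smul]
    refine integral_congr_ae (.of_forall fun y => ?_)
    simp [smul_smul, div_eq_inv_mul]
  rw [← key]
  refine hc.integral_mem hK.isClosed ?_ ?_
  · exact (tilted_absolutelyContinuous _ _).ae_le (ae_restrict_mem hK.measurableSet)
  · rw [integrable_tilted_iff h1]
    exact integrableOn_exp_inner_smul hK continuous_id u

/-- Strict convexity of the log-Laplace transform as a strict tangent-plane inequality: Jensen for
the Gibbs measure at `w`, obtained from `1 + x ≤ exp x`. -/
lemma inner_gibbsMean_lt [FiniteDimensional ℝ E] [μ.IsAddHaarMeasure]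
    (hK : IsCompact K) (hi : (interior K).Nonempty) {u w : E} (huw : u ≠ w) :
    inner ℝ (gibbsMean μ K w) (u - w) <
      Real.log (expMoment μ K (fun _ => (1 : ℝ)) u)
        - Real.log (expMoment μ K (fun _ => (1 : ℝ)) w) := by
  set Z := expMoment μ K (fun _ => (1 : ℝ)) with hZ
  have hZu : 0 < Z u := expMoment_one_pos hK hi u
  have hZw : 0 < Z w := expMoment_one_pos hK hi w
  set h := u - w with hh
  have hh0 : h ≠ 0 := sub_ne_zero.2 huw
  set m := inner ℝ (gibbsMean μ K w) h with hm
  have hmZ : m * Z w = ∫ y in K, Real.exp (inner ℝ w y) * inner ℝ y h ∂μ := by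
    rw [← inner_expMoment_id hK, hm, gibbsMean, inner_smul_left]
    simp only [← hZ]
    simp
    field_simp
  have hZe : ∀ x, Z x = ∫ y in K, Real.exp (inner ℝ x y) ∂μ := fun x => by simp [hZ, expMoment]
  -- The Jensen defect. Centring at the mean `m` makes the linear term integrate to zero against the
  -- weight at `w`.
  let g : E → ℝ := fun y =>
    Real.exp (inner ℝ w y) * (Real.exp (inner ℝ y h - m) - ((inner ℝ y h - m) + 1))
  have hgc : Continuous g := by fun_prop
  have hg0 : 0 ≤ g := fun y =>
    mul_nonneg (Real.exp_pos _).le (sub_nonneg.2 (Real.add_one_le_exp _))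
  have hint : ∀ f : E → ℝ, Continuous f → IntegrableOn f K μ := fun f hf =>
    hf.continuousOn.integrableOn_compact hK
  have hgpos : 0 < ∫ y in K, g y ∂μ := by
    refine (integral_pos_iff_support_of_nonneg hg0 (hint g hgc)).2 ?_
    have hopen : IsOpen (interior K ∩ {y | inner ℝ y h ≠ m}) :=
      isOpen_interior.inter (isOpen_ne_fun (by fun_prop) (by fun_prop))
    -- Strictness: an interior point lying on the hyperplane can be moved off it along `h`.
    have hne : (interior K ∩ {y | inner ℝ y h ≠ m}).Nonempty := by
      obtain ⟨x, hx⟩ := hi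
      by_cases hxm : inner ℝ x h = m
      · have hcont : Filter.Tendsto (fun r : ℝ => x + r • h) (nhds 0) (nhds x) := by
          have : Continuous fun r : ℝ => x + r • h := by fun_prop
          simpa using this.tendsto 0
        have hev := (hcont.eventually (isOpen_interior.mem_nhds hx)).filter_mono
          (nhdsWithin_le_nhds (s := {0}ᶜ))
        obtain ⟨r, hr, hr0⟩ := (hev.and self_mem_nhdsWithin).exists
        refine ⟨x + r • h, hr, ?_⟩
        simp only [Set.mem_ofPred_eq, inner_add_left, hxm, inner_smul_left]
        simpa using ⟨hr0, hh0⟩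
      · exact ⟨x, hx, hxm⟩
    refine (hopen.measure_pos μ hne).trans_le ?_
    rw [Measure.restrict_apply' hK.measurableSet]
    refine measure_mono fun y hy => ⟨?_, interior_subset hy.1⟩
    have : inner ℝ y h - m ≠ 0 := sub_ne_zero.2 hy.2
    exact (mul_pos (Real.exp_pos _) (sub_pos.2 (Real.add_one_lt_exp this))).ne'
  have hsplit : ∫ y in K, g y ∂μ = Real.exp (-m) * Z u - (m * Z w - m * Z w + Z w) := by
    have : g = fun y => Real.exp (-m) * Real.exp (inner ℝ u y) -
        (Real.exp (inner ℝ w y) * inner ℝ y h - m * Real.exp (inner ℝ w y)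
          + Real.exp (inner ℝ w y)) := by
      ext y
      have : Real.exp (-m) * Real.exp (inner ℝ u y) =
          Real.exp (inner ℝ w y) * Real.exp (inner ℝ y h - m) := by
        rw [← Real.exp_add, ← Real.exp_add]
        congr 1
        rw [hh, inner_sub_right, real_inner_comm u y, real_inner_comm w y]
        ring
      rw [this]
      simp only [g]
      ring
    rw [this, integral_sub (hint _ (by fun_prop)) (hint _ (by fun_prop)),
      integral_add (hint _ (by fun_prop)) (hint _ (by fun_prop)),
      integral_sub (hint _ (by fun_prop)) (hint _ (by fun_prop)), integral_const_mul,
      integral_const_mul, ← hZe, ← hZe, ← hmZ]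
  rw [hsplit] at hgpos
  have : Real.exp m * Z w < Z u := by
    have h1 : Z w < Real.exp (-m) * Z u := by linarith
    calc Real.exp m * Z w < Real.exp m * (Real.exp (-m) * Z u) := by gcongr
      _ = Z u := by rw [← mul_assoc, ← Real.exp_add]; simp
  have := Real.log_lt_log (by positivity) this
  rw [Real.log_mul (Real.exp_pos _).ne' hZw.ne', Real.log_exp] at this
  linarith

lemma inner_gibbsMean_sub_pos [FiniteDimensional ℝ E] [μ.IsAddHaarMeasure]
    (hK : IsCompact K) (hi : (interior K).Nonempty) {u w : E} (huw : u ≠ w) :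
    0 < inner ℝ (gibbsMean μ K u - gibbsMean μ K w) (u - w) := by
  have h1 := inner_gibbsMean_lt (μ := μ) hK hi huw
  have h2 := inner_gibbsMean_lt (μ := μ) hK hi huw.symm
  rw [← neg_sub u w, inner_neg_right] at h2
  rw [inner_sub_left]
  linarith

/-- Coercivity, which produces the minimiser in `exists_smul_gibbsMean_add_smul_gibbsMean`: `K`
contains a ball of fixed radius on which `⟪u, y⟫` exceeds `⟪u, x⟫` by at least `δ * ‖u‖`. -/
lemma exists_le_log_expMoment_sub_inner [FiniteDimensional ℝ E] [μ.IsAddHaarMeasure]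
    (hK : IsCompact K) {x : E} (hx : x ∈ interior K) :
    ∃ δ > 0, ∃ C : ℝ, ∀ u : E,
      δ * ‖u‖ - C ≤ Real.log (expMoment μ K (fun _ => (1 : ℝ)) u) - inner ℝ u x := by
  obtain ⟨r, hr, hball⟩ := Metric.mem_nhds_iff.1 (isOpen_interior.mem_nhds hx)
  have hrK : Metric.ball x r ⊆ K := hball.trans interior_subset
  set δ := r / 4 with hδ
  have hδ0 : 0 < δ := by positivity
  set c := μ.real (Metric.ball (0 : E) δ) with hc
  have hc0 : 0 < c := by
    refine ENNReal.toReal_pos (Metric.measure_ball_pos μ 0 hδ0).ne' measure_ball_lt_top.ne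
  refine ⟨δ, hδ0, -Real.log c, fun u => ?_⟩
  suffices h : Real.exp (inner ℝ u x + δ * ‖u‖) * c ≤ expMoment μ K (fun _ => (1 : ℝ)) u by
    have := Real.log_le_log (by positivity) h
    rw [Real.log_mul (Real.exp_pos _).ne' hc0.ne', Real.log_exp] at this
    linarith
  -- Shifting by `2δ` along `u` gains `2δ‖u‖`, the ball of radius `δ` loses at most `δ‖u‖`, and `3δ
  -- < r` keeps it inside `K`.
  obtain ⟨e, he, heu⟩ : ∃ e : E, ‖e‖ ≤ 2 * δ ∧ inner ℝ u e = 2 * δ * ‖u‖ := by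
    rcases eq_or_ne u 0 with rfl | hu
    · exact ⟨0, by simp [hδ0.le], by simp⟩
    · refine ⟨(2 * δ / ‖u‖) • u, ?_, ?_⟩
      · rw [norm_smul, Real.norm_of_nonneg (by positivity)]
        field_simp
        rfl
      · rw [inner_smul_right, real_inner_self_eq_norm_sq]
        field_simp
  have hsub : Metric.ball (x + e) δ ⊆ K := fun y hy => hrK <| by
    rw [mem_ball_iff_norm] at hy ⊢
    calc ‖y - x‖ = ‖(y - (x + e)) + e‖ := by congr 1; abel
      _ ≤ ‖y - (x + e)‖ + ‖e‖ := norm_add_le _ _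
      _ < r := by rw [hδ] at hy he; linarith
  have hint := integrableOn_exp_inner_smul (μ := μ) hK (f := fun _ => (1 : ℝ)) continuous_const u
  have hcc : c = μ.real (Metric.ball (x + e) δ) := by
    rw [hc, measureReal_def, measureReal_def, Measure.addHaar_ball_center μ (x + e)]
  calc Real.exp (inner ℝ u x + δ * ‖u‖) * c
      = ∫ y in Metric.ball (x + e) δ, Real.exp (inner ℝ u x + δ * ‖u‖) ∂μ := by
        rw [setIntegral_const, ← hcc, smul_eq_mul, mul_comm]
    _ ≤ ∫ y in Metric.ball (x + e) δ, Real.exp (inner ℝ u y) • (1 : ℝ) ∂μ := by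
        refine setIntegral_mono_on ?_ (hint.mono_set hsub) measurableSet_ball fun y hy => ?_
        · exact integrableOn_const measure_ball_lt_top.ne
        · rw [smul_eq_mul, mul_one]
          gcongr
          have h1 : inner ℝ u y = inner ℝ u x + inner ℝ u e + inner ℝ u (y - (x + e)) := by
            rw [← inner_add_right, ← inner_add_right]; congr 1; abel
          have h2 := neg_le_of_abs_le (abs_real_inner_le_norm u (y - (x + e)))
          rw [mem_ball_iff_norm] at hy
          have h3 : ‖u‖ * ‖y - (x + e)‖ ≤ ‖u‖ * δ := by gcongr
          rw [h1, heu]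
          linarith
    _ ≤ expMoment μ K (fun _ => (1 : ℝ)) u :=
        setIntegral_mono_set hint (.of_forall fun y => by positivity)
          (Filter.Eventually.of_forall hsub)

end ExponentialFamily

/-! ### Minkowski's theorem: the volume of `K + t • L` is polynomial in `t`. -/

section MinkowskiPolynomial

variable {E : Type*} [NormedAddCommGroup E] [InnerProductSpace ℝ E]

lemma inner_fderiv_apply_self_nonneg {G : E → E} (hG : ∀ u w, 0 ≤ inner ℝ (G u - G w) (u - w))
    {u : E} (hd : DifferentiableAt ℝ G u) (v : E) : 0 ≤ inner ℝ (fderiv ℝ G u v) v := by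
  have hmono : Monotone fun r : ℝ => inner ℝ (G (u + r • v)) v := by
    intro a b hab
    rcases hab.eq_or_lt with rfl | hab
    · rfl
    have h := hG (u + b • v) (u + a • v)
    rw [add_sub_add_left_eq_sub, ← sub_smul, inner_smul_right, inner_sub_left] at h
    exact sub_nonneg.1 (nonneg_of_mul_nonneg_right h (sub_pos.2 hab))
  have hline : HasDerivAt (fun r : ℝ => u + r • v) v 0 := by
    simpa using ((hasDerivAt_id (0 : ℝ)).smul_const v).const_add u
  have h1 : HasDerivAt (fun r : ℝ => G (u + r • v)) (fderiv ℝ G u v) 0 :=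
    HasFDerivAt.comp_hasDerivAt (f := fun r : ℝ => u + r • v) 0
      (by simpa using hd.hasFDerivAt) hline
  have h2 : HasDerivAt (fun r : ℝ => inner ℝ (G (u + r • v)) v) (inner ℝ (fderiv ℝ G u v) v) 0 := by
    simpa using h1.inner ℝ (hasDerivAt_const (0 : ℝ) v)
  rw [← h2.deriv]
  exact hmono.deriv_nonneg

variable [FiniteDimensional ℝ E]

/-- On the segment from the identity to `A` the quadratic form is positive definite before the
endpoint, so the determinant cannot vanish there and change sign. -/
lemma ContinuousLinearMap.det_nonneg_of_inner_nonneg (A : E →L[ℝ] E)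
    (hA : ∀ v, 0 ≤ inner ℝ (A v) v) : 0 ≤ A.det := by
  by_contra! hneg
  let f : ℝ → ℝ := fun r => ((1 - r) • ContinuousLinearMap.id ℝ E + r • A).det
  have hf : Continuous f := ContinuousLinearMap.continuous_det.comp (by fun_prop)
  have hf0 : f 0 = 1 := by simp [f, ContinuousLinearMap.det]
  have hf1 : f 1 = A.det := by simp [f]
  obtain ⟨r, ⟨hr0, hr1⟩, hr⟩ := intermediate_value_Icc' zero_le_one hf.continuousOn
    (show (0 : ℝ) ∈ Set.Icc (f 1) (f 0) by rw [hf0, hf1]; exact ⟨hneg.le, zero_le_one⟩)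
  have hr1' : r < 1 := lt_of_le_of_ne hr1 fun h => by rw [h, hf1] at hr; exact hneg.ne hr
  obtain ⟨v, hv, hv0⟩ := Submodule.exists_mem_ne_zero_of_ne_bot
    (LinearMap.bot_lt_ker_of_det_eq_zero hr).ne'
  have h : (1 - r) • v + r • A v = 0 := by simpa using hv
  have h2 : (1 - r) * inner ℝ v v + r * inner ℝ (A v) v = 0 := by
    rw [← real_inner_smul_left, ← real_inner_smul_left, ← inner_add_left, h, inner_zero_left]
  have h3 : 0 < inner ℝ v v := real_inner_self_pos.2 hv0
  nlinarith [mul_pos (sub_pos.2 hr1') h3, mul_nonneg hr0 (hA v)]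

lemma exists_polynomial_det_add_smul (A B : E →L[ℝ] E) :
    ∃ p : Polynomial ℝ, p.natDegree ≤ Module.finrank ℝ E ∧
      ∀ r : ℝ, (A + r • B).det = p.eval r := by
  let b := Module.finBasis ℝ E
  let MA := LinearMap.toMatrix b b A.toLinearMap
  let MB := LinearMap.toMatrix b b B.toLinearMap
  refine ⟨((Polynomial.X : Polynomial ℝ) • MB.map Polynomial.C + MA.map Polynomial.C).det,
    (Polynomial.natDegree_det_X_add_C_le MB MA).trans (by simp), fun r => ?_⟩
  rw [← Polynomial.coe_evalRingHom, RingHom.map_det, ContinuousLinearMap.det,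
    ← LinearMap.det_toMatrix b]
  congr 1
  ext i j
  simp [MA, MB, add_comm]
  ring

variable [MeasurableSpace E] [BorelSpace E] {μ : Measure E} [μ.IsAddHaarMeasure]

/-- Surjectivity onto `s • interior K + t • interior L`: the equation for `u` is the critical point
equation of the coercive function `H`. -/
lemma exists_smul_gibbsMean_add_smul_gibbsMean {K L : Set E} (hK : IsCompact K)
    (hL : IsCompact L) {s t : ℝ} (hs : 0 < s) (ht : 0 ≤ t) {x y : E} (hx : x ∈ interior K)
    (hy : y ∈ interior L) :
    ∃ u, s • gibbsMean μ K u + t • gibbsMean μ L u = s • x + t • y := by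
  have : ProperSpace E := FiniteDimensional.proper_real E
  obtain ⟨a, ha, C, hC⟩ := exists_le_log_expMoment_sub_inner (μ := μ) hK hx
  obtain ⟨b, hb, D, hD⟩ := exists_le_log_expMoment_sub_inner (μ := μ) hL hy
  let H : E → ℝ := fun u =>
    s * (Real.log (expMoment μ K (fun _ => (1 : ℝ)) u) - innerSL ℝ x u) +
      t * (Real.log (expMoment μ L (fun _ => (1 : ℝ)) u) - innerSL ℝ y u)
  have hH : ∀ u, HasFDerivAt H (s • (innerSL ℝ (gibbsMean μ K u) - innerSL ℝ x) +
      t • (innerSL ℝ (gibbsMean μ L u) - innerSL ℝ y)) u := fun u =>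
    (((hasFDerivAt_log_expMoment hK ⟨x, hx⟩ u).sub (innerSL ℝ x).hasFDerivAt).const_mul s).add
      (((hasFDerivAt_log_expMoment hL ⟨y, hy⟩ u).sub (innerSL ℝ y).hasFDerivAt).const_mul t)
  have hbound : ∀ u, s * a * ‖u‖ + -(s * C + t * D) ≤ H u := fun u => by
    have h1 := mul_le_mul_of_nonneg_left (hC u) hs.le
    have h2 := mul_le_mul_of_nonneg_left (hD u) ht
    have h3 : 0 ≤ t * (b * ‖u‖) := by positivity
    simp only [H, innerSL_apply_apply, real_inner_comm u]
    rw [real_inner_comm, real_inner_comm u y] at *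
    linarith
  have hlim : Filter.Tendsto H (Filter.cocompact E) Filter.atTop :=
    Filter.tendsto_atTop_mono hbound (Filter.tendsto_atTop_add_const_right _ _
      ((tendsto_norm_cocompact_atTop (E := E)).const_mul_atTop (by positivity)))
  obtain ⟨u, hu⟩ := (Differentiable.continuous fun u => (hH u).differentiableAt).exists_forall_le
    hlim
  refine ⟨u, ?_⟩
  have h0 := IsLocalMin.hasFDerivAt_eq_zero (.of_forall hu) (hH u)
  refine ext_inner_right ℝ fun v => ?_
  have := congrArg (fun T : E →L[ℝ] ℝ => T v) h0
  simp [inner_add_left, inner_smul_left] at this ⊢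
  linarith

/-- Change of variables along an injective map whose image lies between `s • interior K + t •
interior L` and `s • K + t • L`; these differ by a subset of the null frontier of a convex set. -/
lemma measureReal_smul_add_smul {K L : Set E} (hK : IsCompact K) (hKc : Convex ℝ K)
    (hKi : (interior K).Nonempty) (hL : IsCompact L) (hLc : Convex ℝ L)
    (hLi : (interior L).Nonempty) {s t : ℝ} (hs : 0 < s) (ht : 0 ≤ t) :
    Integrable (fun u =>
        (s • fderiv ℝ (gibbsMean μ K) u + t • fderiv ℝ (gibbsMean μ L) u).det) μ ∧
      μ.real (s • K + t • L) =
        ∫ u, (s • fderiv ℝ (gibbsMean μ K) u + t • fderiv ℝ (gibbsMean μ L) u).det ∂μ := by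
  set F : E → E := fun u => s • gibbsMean μ K u + t • gibbsMean μ L u with hF
  set F' : E → E →L[ℝ] E := fun u =>
    s • fderiv ℝ (gibbsMean μ K) u + t • fderiv ℝ (gibbsMean μ L) u with hF'
  have hder : ∀ u, HasFDerivAt F (F' u) u := fun u =>
    ((differentiable_gibbsMean (μ := μ) hK hKi u).hasFDerivAt.const_smul s).add
      ((differentiable_gibbsMean (μ := μ) hL hLi u).hasFDerivAt.const_smul t)
  have hmonoL : ∀ u w, 0 ≤ inner ℝ (gibbsMean μ L u - gibbsMean μ L w) (u - w) := fun u w => by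
    rcases eq_or_ne u w with rfl | h
    · simp
    · exact (inner_gibbsMean_sub_pos (μ := μ) hL hLi h).le
  have hpos : ∀ u w, u ≠ w → 0 < inner ℝ (F u - F w) (u - w) := fun u w h => by
    have h1 := inner_gibbsMean_sub_pos (μ := μ) hK hKi h
    have h2 := hmonoL u w
    have : F u - F w = s • (gibbsMean μ K u - gibbsMean μ K w) +
        t • (gibbsMean μ L u - gibbsMean μ L w) := by simp only [hF, smul_sub]; abel
    rw [this, inner_add_left, real_inner_smul_left, real_inner_smul_left]
    positivity
  have hinj : Function.Injective F := fun u w h => by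
    by_contra hne
    have := hpos u w hne
    simp [h] at this
  have hdet : ∀ u, |(F' u).det| = (F' u).det := fun u => by
    refine abs_of_nonneg (ContinuousLinearMap.det_nonneg_of_inner_nonneg _ fun v => ?_)
    rw [← (hder u).fderiv]
    refine inner_fderiv_apply_self_nonneg (fun u w => ?_) (hder u).differentiableAt v
    rcases eq_or_ne u w with rfl | h
    · simp
    · exact (hpos u w h).le
  have hsub : F '' Set.univ ⊆ s • K + t • L := by
    rintro _ ⟨u, -, rfl⟩
    exact Set.add_mem_add (Set.smul_mem_smul_set (gibbsMean_mem (μ := μ) hK hKc hKi u))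
      (Set.smul_mem_smul_set (gibbsMean_mem (μ := μ) hL hLc hLi u))
  have hsup : s • interior K + t • interior L ⊆ F '' Set.univ := by
    rintro _ ⟨_, ⟨x, hx, rfl⟩, _, ⟨y, hy, rfl⟩, rfl⟩
    obtain ⟨u, hu⟩ := exists_smul_gibbsMean_add_smul_gibbsMean (μ := μ) hK hL hs ht hx hy
    exact ⟨u, trivial, hu⟩
  have hclos : s • K + t • L ⊆ closure (s • interior K + t • interior L) := by
    rintro _ ⟨_, ⟨x, hx, rfl⟩, _, ⟨y, hy, rfl⟩, rfl⟩
    have hx' : x ∈ closure (interior K) := by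
      rw [hKc.closure_interior_eq_closure_of_nonempty_interior hKi]; exact subset_closure hx
    have hy' : y ∈ closure (interior L) := by
      rw [hLc.closure_interior_eq_closure_of_nonempty_interior hLi]; exact subset_closure hy
    exact map_mem_closure₂ (f := fun x y => s • x + t • y) (by fun_prop) hx' hy'
      fun a ha b hb => Set.add_mem_add (Set.smul_mem_smul_set ha) (Set.smul_mem_smul_set hb)
  have hconv : Convex ℝ (s • interior K + t • interior L) :=
    (hKc.interior.smul s).add (hLc.interior.smul t)
  have hμclos : μ (closure (s • interior K + t • interior L)) ≤
      μ (s • interior K + t • interior L) := by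
    rw [closure_eq_self_union_frontier]
    refine (measure_union_le _ _).trans ?_
    rw [hconv.addHaar_frontier μ, add_zero]
  have hμ : μ (F '' Set.univ) = μ (s • K + t • L) :=
    le_antisymm (measure_mono hsub)
      ((measure_mono hclos).trans (hμclos.trans (measure_mono hsup)))
  have hfin : μ (F '' Set.univ) ≠ ⊤ := by
    rw [hμ]; exact ((hK.smul s).add (hL.smul t)).measure_lt_top.ne
  have hint := (integrableOn_image_iff_integrableOn_abs_det_fderiv_smul μ MeasurableSet.univ
    (fun u _ => (hder u).hasFDerivWithinAt) hinj.injOn (fun _ => (1 : ℝ))).1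
    (integrableOn_const hfin)
  have heq := integral_image_eq_integral_abs_det_fderiv_smul μ MeasurableSet.univ
    (fun u _ => (hder u).hasFDerivWithinAt) hinj.injOn (fun _ => (1 : ℝ))
  simp only [hdet, smul_eq_mul, mul_one, integrableOn_univ, setIntegral_univ, setIntegral_const,
    measureReal_def, hμ] at hint heq
  exact ⟨hint, heq⟩

theorem exists_polynomial_measureReal_add_smul {K L : Set E} (hK : IsCompact K)
    (hKc : Convex ℝ K) (hKi : (interior K).Nonempty) (hL : IsCompact L) (hLc : Convex ℝ L)
    (hLi : (interior L).Nonempty) :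
    ∃ p : Polynomial ℝ, p.natDegree ≤ Module.finrank ℝ E ∧
      ∀ t : ℝ, 0 ≤ t → μ.real (K + t • L) = p.eval t := by
  set d := Module.finrank ℝ E
  have key := fun (t : ℝ) (ht : 0 ≤ t) =>
    measureReal_smul_add_smul (μ := μ) hK hKc hKi hL hLc hLi one_pos ht
  simp only [one_smul] at key
  set A := fderiv ℝ (gibbsMean μ K)
  set B := fderiv ℝ (gibbsMean μ L)
  have hnode : Set.InjOn (fun i : ℕ => (i : ℝ)) (Finset.range (d + 1)) :=
    Nat.cast_injective.injOn
  -- Lagrange interpolation at `0, …, d` writes the integrand through its values at the nodes, whose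
  -- integrability is known, so the coefficients need not be integrated separately.
  have hdet : ∀ u t, (A u + t • B u).det = ∑ i ∈ Finset.range (d + 1),
      (A u + (i : ℝ) • B u).det *
        (Lagrange.basis (Finset.range (d + 1)) (fun i : ℕ => (i : ℝ)) i).eval t := fun u t => by
    obtain ⟨p, hp, hpe⟩ := exists_polynomial_det_add_smul (A u) (B u)
    have := Lagrange.eq_interpolate (f := p) hnode (by
      rw [Finset.card_range]
      exact lt_of_le_of_lt Polynomial.degree_le_natDegree
        (by exact_mod_cast Nat.lt_succ_of_le hp))
    rw [hpe, this, Lagrange.interpolate_apply, Polynomial.eval_finsetSum]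
    simp [hpe]
  refine ⟨Lagrange.interpolate (Finset.range (d + 1)) (fun i : ℕ => (i : ℝ))
    fun i : ℕ => μ.real (K + (i : ℝ) • L), ?_, fun t ht => ?_⟩
  · have := Lagrange.degree_interpolate_lt (fun i : ℕ => μ.real (K + (i : ℝ) • L)) hnode
    rw [Finset.card_range] at this
    exact Polynomial.natDegree_le_of_degree_le (Order.le_of_lt_succ this)
  · rw [(key t ht).2, Lagrange.interpolate_apply, Polynomial.eval_finsetSum]
    simp_rw [hdet _ t]
    rw [integral_finsetSum _ fun (i : ℕ) _ => ((key i (Nat.cast_nonneg i)).1).mul_const _]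
    simp [integral_mul_const, (key _ (Nat.cast_nonneg _)).2]

end MinkowskiPolynomial

/-! ### The Rogers–Shephard inequality. -/

section RogersShephard

lemma integral_pow_mul_one_sub_pow (a b : ℕ) :
    ∫ t in (0 : ℝ)..1, t ^ a * (1 - t) ^ b =
      (a.factorial * b.factorial : ℝ) / (a + b + 1).factorial := by
  induction a generalizing b with
  | zero =>
    rw [intervalIntegral.integral_congr (g := fun t : ℝ => (1 - t) ^ b) (fun t _ => by simp),
      intervalIntegral.integral_comp_sub_left (fun x : ℝ => x ^ b), integral_pow]
    have : (b.factorial : ℝ) ≠ 0 := by positivity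
    simp [Nat.factorial_succ]
    field_simp
  | succ a ih =>
    have hder : ∀ t ∈ Set.uIcc (0 : ℝ) 1, HasDerivAt
        (fun t : ℝ => t ^ (a + 1) * (1 - t) ^ (b + 1))
        ((a + 1) * (t ^ a * (1 - t) ^ (b + 1)) - (b + 1) * (t ^ (a + 1) * (1 - t) ^ b)) t := by
      intro t _
      have h1 : HasDerivAt (fun t : ℝ => t ^ (a + 1)) ((a + 1 : ℕ) * t ^ a) t := by
        simpa using hasDerivAt_pow (a + 1) t
      have h2 : HasDerivAt (fun t : ℝ => (1 - t) ^ (b + 1)) (-((b + 1 : ℕ) * (1 - t) ^ b)) t := by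
        simpa using ((hasDerivAt_id t).const_sub 1).fun_pow (b + 1)
      refine (h1.mul h2).congr_deriv ?_
      push_cast
      ring
    have h := intervalIntegral.integral_eq_sub_of_hasDerivAt hder
      (Continuous.intervalIntegrable (by fun_prop) _ _)
    rw [intervalIntegral.integral_sub (Continuous.intervalIntegrable (by fun_prop) _ _)
      (Continuous.intervalIntegrable (by fun_prop) _ _), intervalIntegral.integral_const_mul,
      intervalIntegral.integral_const_mul, ih] at h
    simp only [one_pow, sub_self, ne_eq, Nat.add_eq_zero_iff, one_ne_zero, and_false,
      not_false_eq_true, zero_pow, mul_zero, sub_zero, mul_one] at h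
    have hb : (b + 1 : ℝ) ≠ 0 := by positivity
    have e : a + (b + 1) + 1 = a + 1 + b + 1 := by ring
    rw [e] at h
    apply mul_left_cancel₀ hb
    rw [← sub_eq_zero.1 h, Nat.factorial_succ a, Nat.factorial_succ b]
    push_cast
    ring

lemma setOf_gauge_lt_eq_smul {E : Type*} [AddCommGroup E] [Module ℝ E] {D : Set E} {r : ℝ} (hr : 0 < r) :
    {x | gauge D x < r} = r • {x | gauge D x < 1} := by
  ext x
  rw [Set.mem_smul_set_iff_inv_smul_mem₀ hr.ne']
  simp only [Set.mem_ofPred_eq]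
  rw [gauge_smul_of_nonneg (inv_nonneg.2 hr.le), smul_eq_mul, inv_mul_lt_iff₀ hr, mul_one]

variable {E : Type*} [NormedAddCommGroup E] [MeasurableSpace E] [BorelSpace E] {μ : Measure E}

/-- Tonelli, applied to the product of indicators of `y ∈ K` and `y - x ∈ K`. -/
lemma lintegral_measure_inter_vadd [SecondCountableTopology E] [SFinite μ] [μ.IsAddLeftInvariant]
    [μ.IsNegInvariant] {K : Set E} (hK : MeasurableSet K) :
    ∫⁻ x, μ (K ∩ (x +ᵥ K)) ∂μ = μ K * μ K := by
  have h1 : ∀ x, μ (K ∩ (x +ᵥ K)) =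
      ∫⁻ y, K.indicator 1 y * K.indicator (1 : E → ENNReal) (y - x) ∂μ := fun x => by
    rw [← lintegral_indicator_one (hK.inter (hK.const_vadd x)), Set.inter_indicator_one]
    refine lintegral_congr fun y => ?_
    have : y ∈ x +ᵥ K ↔ y - x ∈ K := by
      rw [Set.mem_vadd_set_iff_neg_vadd_mem, vadd_eq_add, neg_add_eq_sub]
    by_cases h : y - x ∈ K
    · simp [Set.indicator, this.2 h, h]
    · simp [Set.indicator, mt this.1 h, h]
  have hm : Measurable (K.indicator (1 : E → ENNReal)) := measurable_one.indicator hK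
  simp_rw [h1]
  rw [lintegral_lintegral_swap (by fun_prop)]
  have h2 : ∀ y, ∫⁻ x, K.indicator 1 y * K.indicator (1 : E → ENNReal) (y - x) ∂μ =
      K.indicator 1 y * μ K := fun y => by
    rw [lintegral_const_mul _ (by fun_prop),
      lintegral_sub_left_eq_self (μ := μ) (K.indicator (1 : E → ENNReal)) y,
      lintegral_indicator_one hK]
  simp_rw [h2]
  rw [lintegral_mul_const _ hm, lintegral_indicator_one hK]

variable [NormedSpace ℝ E] [FiniteDimensional ℝ E] [μ.IsAddHaarMeasure]

/-- If `x = r • (a - b)` with `a, b ∈ K`, the intersection contains `r • a + (1 - r) • K`. -/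
lemma measure_inter_vadd_ge {K : Set E} (hKc : Convex ℝ K) {r : ℝ} (hr0 : 0 ≤ r)
    (hr1 : r ≤ 1) {x : E} (hx : x ∈ r • (K - K)) :
    ENNReal.ofReal ((1 - r) ^ Module.finrank ℝ E) * μ K ≤ μ (K ∩ (x +ᵥ K)) := by
  obtain ⟨_, ⟨a, ha, b, hb, rfl⟩, rfl⟩ := hx
  have hr : 0 ≤ 1 - r := sub_nonneg.2 hr1
  have h : r • a +ᵥ (1 - r) • K ⊆ K ∩ (r • (a - b) +ᵥ K) := by
    rintro _ ⟨_, ⟨k, hk, rfl⟩, rfl⟩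
    refine ⟨hKc ha hk hr0 hr (by ring), r • b + (1 - r) • k, hKc hb hk hr0 hr (by ring), ?_⟩
    simp only [vadd_eq_add, smul_sub]
    abel
  refine le_trans (le_of_eq ?_) (measure_mono h)
  rw [measure_vadd, Measure.addHaar_smul, abs_of_nonneg (by positivity)]

/-- Layer cake: the level set at height `t` is `(1 - t) • D` up to a null set, leaving the Beta
integral of `d * t ^ (d - 1) * (1 - t) ^ d`, which is `1 / centralBinom d`. -/
lemma lintegral_one_sub_gauge_pow_ge {D : Set E} (hDc : Convex ℝ D) (hD0 : D ∈ nhds 0)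
    (hd : 0 < Module.finrank ℝ E) :
    μ D * ENNReal.ofReal (1 / (Module.finrank ℝ E).centralBinom) ≤
      ∫⁻ x, ENNReal.ofReal ((max (1 - gauge D x) 0) ^ Module.finrank ℝ E) ∂μ := by
  set d := Module.finrank ℝ E with hdd
  have hgc : Continuous (gauge D) := continuous_gauge hDc hD0
  have hlayer := lintegral_comp_eq_lintegral_meas_lt_mul μ (f := fun x => max (1 - gauge D x) 0)
    (g := fun t => d * t ^ (d - 1)) (.of_forall fun x => le_max_right _ _)
    (by fun_prop) (fun t _ => Continuous.intervalIntegrable (by fun_prop) _ _)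
    (by filter_upwards [ae_restrict_mem measurableSet_Ioi] with t ht
        have : (0 : ℝ) < t := ht
        positivity)
  have hint : ∀ y : ℝ, ∫ t in (0 : ℝ)..y, d * t ^ (d - 1) = y ^ d := fun y => by
    rw [intervalIntegral.integral_const_mul, integral_pow]
    have : ((d - 1 : ℕ) : ℝ) + 1 = d := by exact_mod_cast Nat.sub_add_cancel hd
    rw [this, Nat.sub_add_cancel hd, zero_pow hd.ne', sub_zero]
    field_simp
  simp_rw [hint] at hlayer
  rw [hlayer]
  have hlevel : ∀ t ∈ Set.Ioo (0 : ℝ) 1, μ {x | t < max (1 - gauge D x) 0} =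
      ENNReal.ofReal ((1 - t) ^ d) * μ D := fun t ht => by
    have h1 : {x | t < max (1 - gauge D x) 0} = {x | gauge D x < 1 - t} := by
      ext x
      simp only [Set.mem_ofPred_eq, lt_max_iff]
      constructor
      · rintro (h | h)
        · linarith
        · exact absurd h ht.1.le.not_gt
      · intro h; left; linarith
    rw [h1, setOf_gauge_lt_eq_smul (sub_pos.2 ht.2), Measure.addHaar_smul,
      abs_of_nonneg (pow_nonneg (sub_pos.2 ht.2).le _), setOfPred_gauge_lt_one_eq_interior hDc hD0]
    congr 1
    refine le_antisymm (measure_mono interior_subset) ?_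
    calc μ D ≤ μ (interior D ∪ frontier D) := measure_mono (by
          rw [← closure_eq_interior_union_frontier]; exact subset_closure)
      _ ≤ μ (interior D) + μ (frontier D) := measure_union_le _ _
      _ = μ (interior D) := by rw [hDc.addHaar_frontier μ, add_zero]
  have hbeta : ∫ t in Set.Ioo (0 : ℝ) 1, d * t ^ (d - 1) * (1 - t) ^ d =
      1 / (d.centralBinom : ℝ) := by
    rw [← integral_Ioc_eq_integral_Ioo, ← intervalIntegral.integral_of_le zero_le_one]
    simp_rw [mul_assoc]
    rw [intervalIntegral.integral_const_mul, integral_pow_mul_one_sub_pow]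
    have e : d - 1 + d + 1 = 2 * d := by omega
    rw [e, Nat.centralBinom_eq_two_mul_choose, Nat.cast_choose ℝ (by omega : d ≤ 2 * d),
      ← Nat.mul_factorial_pred hd.ne', show 2 * d - d = d by omega]
    have := Nat.factorial_ne_zero (2 * d)
    have := Nat.factorial_ne_zero (d - 1)
    rw [← Nat.mul_factorial_pred hd.ne']
    push_cast
    field_simp
  calc μ D * ENNReal.ofReal (1 / d.centralBinom)
      = μ D * ∫⁻ t in Set.Ioo (0 : ℝ) 1, ENNReal.ofReal (d * t ^ (d - 1) * (1 - t) ^ d) := by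
        rw [← hbeta, ofReal_integral_eq_lintegral_ofReal]
        · refine IntegrableOn.mono_set (t := Set.Icc 0 1) ?_ Set.Ioo_subset_Icc_self
          exact Continuous.integrableOn_Icc (by fun_prop)
        · filter_upwards [ae_restrict_mem measurableSet_Ioo] with t ht
          have h1 : 0 < t := ht.1
          have h2 : 0 < 1 - t := sub_pos.2 ht.2
          simp only [Pi.zero_apply]
          positivity
    _ = ∫⁻ t in Set.Ioo (0 : ℝ) 1, μ {x | t < max (1 - gauge D x) 0} *
          ENNReal.ofReal (d * t ^ (d - 1)) := by
        rw [← lintegral_const_mul _ (by fun_prop)]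
        refine setLIntegral_congr_fun measurableSet_Ioo fun t ht => ?_
        have h1 : 0 < t := ht.1
        rw [hlevel t ht, ENNReal.ofReal_mul (by positivity)]
        ring
    _ ≤ ∫⁻ t in Set.Ioi (0 : ℝ), μ {x | t < max (1 - gauge D x) 0} *
          ENNReal.ofReal (d * t ^ (d - 1)) :=
        lintegral_mono_set Set.Ioo_subset_Ioi_self

/-- The **Rogers–Shephard inequality**. -/
theorem measureReal_sub_self_le {K : Set E} (hK : IsCompact K) (hKc : Convex ℝ K)
    (hKi : (interior K).Nonempty) (hd : 0 < Module.finrank ℝ E) :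
    μ.real (K - K) ≤ (Module.finrank ℝ E).centralBinom * μ.real K := by
  set d := Module.finrank ℝ E with hdd
  set D := K - K with hD
  have hDc : Convex ℝ D := hKc.sub hKc
  have hDcomp : IsCompact D := by
    rw [hD, sub_eq_add_neg]
    exact hK.add hK.neg
  have hD0 : D ∈ nhds 0 := by
    obtain ⟨x, hx⟩ := hKi
    refine mem_interior_iff_mem_nhds.1 (interior_maximal ?_ (isOpen_interior.sub_right (t := {x}))
      ⟨x, hx, x, rfl, sub_self x⟩)
    exact Set.sub_subset_sub interior_subset (Set.singleton_subset_iff.2 (interior_subset hx))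
  have hmem : ∀ x, x ∈ gauge D x • D := fun x => by
    rcases eq_or_ne x 0 with rfl | hx
    · rw [gauge_zero, Set.zero_smul_set ⟨0, mem_of_mem_nhds hD0⟩]; rfl
    have hg : 0 < gauge D x :=
      (gauge_pos (absorbent_nhds_zero hD0) ((NormedSpace.isVonNBounded_iff ℝ).2 hDcomp.isBounded)).2 hx
    rw [Set.mem_smul_set_iff_inv_smul_mem₀ hg.ne']
    suffices h : (gauge D x)⁻¹ • x ∈ closure D by rwa [hDcomp.isClosed.closure_eq] at h
    refine (gauge_le_one_iff_mem_closure hDc hD0).1 ?_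
    rw [gauge_smul_of_nonneg (inv_nonneg.2 hg.le),
      smul_eq_mul, inv_mul_cancel₀ hg.ne']
  have hμ0 : μ K ≠ 0 :=
    ((isOpen_interior.measure_pos μ hKi).trans_le (measure_mono interior_subset)).ne'
  have hμt : μ K ≠ ⊤ := hK.measure_lt_top.ne
  have key : μ D * ENNReal.ofReal (1 / d.centralBinom) * μ K ≤ μ K * μ K := by
    calc μ D * ENNReal.ofReal (1 / d.centralBinom) * μ K
        ≤ (∫⁻ x, ENNReal.ofReal ((max (1 - gauge D x) 0) ^ d) ∂μ) * μ K := by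
          gcongr
          exact lintegral_one_sub_gauge_pow_ge hDc hD0 hd
      _ = ∫⁻ x, ENNReal.ofReal ((max (1 - gauge D x) 0) ^ d) * μ K ∂μ := by
          have := continuous_gauge hDc hD0
          rw [lintegral_mul_const _ (by fun_prop)]
      _ ≤ ∫⁻ x, μ (K ∩ (x +ᵥ K)) ∂μ := by
          refine lintegral_mono fun x => ?_
          rcases le_total (gauge D x) 1 with h | h
          · simp only [max_eq_left (sub_nonneg.2 h)]
            exact measure_inter_vadd_ge hKc (gauge_nonneg x) h (hmem x)
          · simp [max_eq_right (sub_nonpos.2 h), hd.ne']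
      _ = μ K * μ K := lintegral_measure_inter_vadd hK.measurableSet
  rw [ENNReal.mul_le_mul_iff_left hμ0 hμt] at key
  have h := ENNReal.toReal_mono hμt key
  have hC : (0 : ℝ) < d.centralBinom := by exact_mod_cast d.centralBinom_pos
  rw [ENNReal.toReal_mul, ENNReal.toReal_ofReal (by positivity), mul_one_div, div_le_iff₀ hC] at h
  rw [measureReal_def, measureReal_def]
  linarith

end RogersShephard

/-! ### Sums of points of a convex set. -/

section Helly

variable {E : Type*} [AddCommGroup E] [Module ℝ E]

lemma Convex.sum_mem_card_smul {ι : Type*} {K : Set E} (hK : Convex ℝ K) (hne : K.Nonempty)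
    (s : Finset ι) {f : ι → E} (hf : ∀ i ∈ s, f i ∈ K) : ∑ i ∈ s, f i ∈ (s.card : ℝ) • K := by
  classical
  induction s using Finset.induction_on with
  | empty => simp [Set.zero_smul_set hne]
  | insert a s ha ih =>
    rw [Finset.sum_insert ha, Finset.card_insert_of_notMem ha, Nat.cast_add, add_comm (f a),
      hK.add_smul (Nat.cast_nonneg _) (Nat.cast_nonneg _), Nat.cast_one, one_smul]
    exact Set.add_mem_add (ih fun i hi => hf i (Finset.mem_insert_of_mem hi))
      (hf a (Finset.mem_insert_self _ _))

end Helly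

/-! ### Covering `-K` by a dilate of `K`. -/

section Reflection

variable {E : Type*} [NormedAddCommGroup E] [NormedSpace ℝ E] [FiniteDimensional ℝ E]

/-- Some translate of `-K` is contained in `d • K`, where `d` is the dimension. -/
lemma exists_forall_sub_mem_finrank_smul {K : Set E} (hK : IsCompact K) (hKc : Convex ℝ K)
    (hne : K.Nonempty) : ∃ c : E, ∀ x ∈ K, c - x ∈ (Module.finrank ℝ E : ℝ) • K := by
  classical
  set d := Module.finrank ℝ E
  obtain ⟨x₀, hx₀⟩ := hne
  -- By Helly it suffices to intersect at most `d + 1` of the sets `x + d • K`. The sum of the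
  -- chosen points, padded by copies of `x₀` to `d + 1` terms, works: removing one summand leaves a
  -- sum of `d` points of `K`.
  have h := Convex.helly_theorem_compact' (𝕜 := ℝ) (F := fun x : K => (x : E) +ᵥ (d : ℝ) • K)
    (fun x => (hKc.smul _).vadd _) (fun x => (hK.smul _).vadd _) fun I hI => by
      rcases I.eq_empty_or_nonempty with rfl | hIne
      · simp
      refine ⟨∑ x ∈ I, (x : E) + ((d + 1 - I.card : ℕ) : ℝ) • x₀, ?_⟩
      simp only [Set.mem_iInter]
      intro j hj
      rw [Set.mem_vadd_set_iff_neg_vadd_mem, vadd_eq_add, ← Finset.add_sum_erase I _ hj, add_assoc,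
        neg_add_cancel_left]
      have hcard := Finset.card_pos.2 hIne
      have e : (d : ℝ) = ((I.erase j).card : ℝ) + ((d + 1 - I.card : ℕ) : ℝ) := by
        rw [Finset.card_erase_of_mem hj]
        norm_cast
        omega
      rw [e, hKc.add_smul (Nat.cast_nonneg _) (Nat.cast_nonneg _)]
      exact Set.add_mem_add (hKc.sum_mem_card_smul ⟨x₀, hx₀⟩ _ fun i _ => i.2)
        (Set.smul_mem_smul_set hx₀)
  obtain ⟨c, hc⟩ := h
  refine ⟨c, fun x hx => ?_⟩
  have := Set.mem_iInter.1 hc ⟨x, hx⟩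
  rwa [Set.mem_vadd_set_iff_neg_vadd_mem, vadd_eq_add, neg_add_eq_sub] at this

lemma measureReal_add_smul_neg_le [MeasurableSpace E] [BorelSpace E] {μ : Measure E}
    [μ.IsAddHaarMeasure] {K : Set E} (hK : IsCompact K) (hKc : Convex ℝ K) (hne : K.Nonempty)
    {t : ℝ} (ht : 0 ≤ t) :
    μ.real (K + t • (-K)) ≤
      (1 + Module.finrank ℝ E * t) ^ Module.finrank ℝ E * μ.real K := by
  set d := Module.finrank ℝ E with hd
  obtain ⟨c, hc⟩ := exists_forall_sub_mem_finrank_smul hK hKc hne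
  have hsub : K + t • (-K) ⊆ -(t • c) +ᵥ (1 + d * t) • K := by
    rintro _ ⟨x, hx, _, ⟨y, hy, rfl⟩, rfl⟩
    obtain ⟨k, hk, hk'⟩ := hc (-y) hy
    rw [Set.mem_vadd_set_iff_neg_vadd_mem, hKc.add_smul zero_le_one (by positivity), one_smul]
    refine ⟨x, hx, (d * t) • k, Set.smul_mem_smul_set hk, ?_⟩
    have : (d : ℝ) • k = c + y := by simpa using hk'
    rw [mul_comm, mul_smul, this]
    simp only [vadd_eq_add, neg_neg, smul_add]
    abel
  calc μ.real (K + t • (-K)) ≤ μ.real (-(t • c) +ᵥ (1 + d * t) • K) :=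
        measureReal_mono hsub ((hK.smul _).vadd _).measure_lt_top.ne
    _ = (1 + d * t) ^ d * μ.real K := by
        rw [measureReal_def, measure_vadd, Measure.addHaar_smul, ENNReal.toReal_mul,
          ENNReal.toReal_ofReal (abs_nonneg _), abs_of_nonneg (by positivity), measureReal_def]

end Reflection

/-! ### Coefficient bounds and the upper estimate in dimensions 4 and 5. -/

section DifferenceBodyBound

/-- Compares right derivatives at `0`: `(q - p) / X` is nonnegative for `t > 0`, hence at `0`. -/
lemma Polynomial.coeff_one_le_of_eval_le {p q : Polynomial ℝ} (h0 : p.eval 0 = q.eval 0)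
    (h : ∀ t, 0 ≤ t → p.eval t ≤ q.eval t) : p.coeff 1 ≤ q.coeff 1 := by
  have h1 : ∀ t : ℝ, 0 < t → 0 ≤ (q - p).divX.eval t := fun t ht => by
    have h2 := congrArg (Polynomial.eval t) (Polynomial.divX_mul_X_add (q - p))
    have h3 : (q - p).coeff 0 = 0 := by
      rw [Polynomial.coeff_zero_eq_eval_zero, Polynomial.eval_sub, h0, sub_self]
    rw [h3] at h2
    simp only [map_zero, add_zero, Polynomial.eval_mul, Polynomial.eval_X,
      Polynomial.eval_sub] at h2
    exact nonneg_of_mul_nonneg_left (h2 ▸ sub_nonneg.2 (h t ht.le)) ht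
  have hlim : Filter.Tendsto (fun t => (q - p).divX.eval t) (nhdsWithin 0 (Set.Ioi 0))
      (nhds ((q - p).divX.eval 0)) :=
    ((q - p).divX.continuous.tendsto 0).mono_left nhdsWithin_le_nhds
  have h4 : 0 ≤ (q - p).divX.eval 0 :=
    ge_of_tendsto hlim (Filter.eventually_of_mem self_mem_nhdsWithin h1)
  rw [← Polynomial.coeff_zero_eq_eval_zero, Polynomial.coeff_divX] at h4
  simpa using h4

lemma Polynomial.coeff_eq_coeff_sub_of_eval_eq {p : Polynomial ℝ} {d : ℕ}
    (h : ∀ t : ℝ, 0 < t → p.eval t = t ^ d * p.eval t⁻¹) (hd : p.natDegree ≤ d) {i : ℕ}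
    (hi : i ≤ d) : p.coeff i = p.coeff (d - i) := by
  have hp : p.reflect d = p := by
    refine Polynomial.eq_of_infinite_eval_eq _ _ ((Set.Ioi_infinite (0 : ℝ)).mono fun t ht => ?_)
    have ht0 : (0 : ℝ) < t := ht
    have : Invertible t⁻¹ := invertibleOfNonzero (inv_ne_zero ht0.ne')
    have h1 := Polynomial.eval₂_reflect_mul_pow (RingHom.id ℝ) t⁻¹ d p hd
    simp only [invOf_eq_inv, inv_inv, Polynomial.eval₂_id] at h1
    rw [Set.mem_ofPred_eq, h t ht0, ← h1, mul_comm, mul_assoc, ← mul_pow, inv_mul_cancel₀ ht0.ne', one_pow,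
      mul_one]
  conv_lhs => rw [← hp]
  rw [Polynomial.coeff_reflect, Polynomial.revAt_le hi]

variable {E : Type*} [NormedAddCommGroup E] [InnerProductSpace ℝ E] [FiniteDimensional ℝ E]
  [MeasurableSpace E] [BorelSpace E] {μ : Measure E} [μ.IsAddHaarMeasure]

lemma measureReal_add_smul_neg_inv (K : Set E) {t : ℝ} (ht : 0 < t) :
    μ.real (K + t • (-K)) = t ^ Module.finrank ℝ E * μ.real (K + t⁻¹ • (-K)) := by
  have h : K + t • (-K) = (-t) • (K + t⁻¹ • (-K)) := by
    rw [smul_add, smul_smul, neg_mul, mul_inv_cancel₀ ht.ne', add_comm, Set.neg_smul_set,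
      Set.neg_smul_set, one_smul, neg_neg, Set.smul_set_neg]
  rw [h, measureReal_def, Measure.addHaar_smul, ENNReal.toReal_mul,
    ENNReal.toReal_ofReal (abs_nonneg _), abs_pow, abs_neg, abs_of_pos ht, measureReal_def]

lemma exists_palindromic_polynomial_measureReal {K : Set E} (hK : IsCompact K)
    (hKc : Convex ℝ K) (hKi : (interior K).Nonempty) (hd : 0 < Module.finrank ℝ E) :
    ∃ p : Polynomial ℝ, p.natDegree ≤ Module.finrank ℝ E ∧
      (∀ t : ℝ, 0 ≤ t → μ.real (K + t • (-K)) = p.eval t) ∧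
      (∀ i ≤ Module.finrank ℝ E, p.coeff i = p.coeff (Module.finrank ℝ E - i)) ∧
      p.coeff 0 = μ.real K ∧ p.coeff 1 ≤ (Module.finrank ℝ E : ℝ) ^ 2 * μ.real K ∧
      p.eval 1 ≤ (Module.finrank ℝ E).centralBinom * μ.real K := by
  set d := Module.finrank ℝ E
  have hne : K.Nonempty := hKi.mono interior_subset
  obtain ⟨p, hp, hpe⟩ := exists_polynomial_measureReal_add_smul (μ := μ) hK hKc hKi hK.neg hKc.neg
    (by
      obtain ⟨x, hx⟩ := hKi
      exact ⟨-x, (Homeomorph.neg E).preimage_interior K ▸ (by simpa using hx)⟩)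
  have hp0 : p.eval 0 = μ.real K := by
    rw [← hpe 0 le_rfl, Set.zero_smul_set hne.neg, add_zero]
  refine ⟨p, hp, hpe, fun i hi => ?_, ?_, ?_, ?_⟩
  · refine Polynomial.coeff_eq_coeff_sub_of_eval_eq (fun t ht => ?_) hp hi
    rw [← hpe t ht.le, ← hpe t⁻¹ (inv_nonneg.2 ht.le), measureReal_add_smul_neg_inv K ht]
  · rw [Polynomial.coeff_zero_eq_eval_zero, hp0]
  -- The majorant from `measureReal_add_smul_neg_le`; it agrees with `p` at `0` and has slope `d²
  -- μ(K)` there.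
  · let q : Polynomial ℝ := (1 + Polynomial.C (d : ℝ) * Polynomial.X) ^ d * Polynomial.C (μ.real K)
    have hq : q.coeff 1 = (d : ℝ) ^ 2 * μ.real K := by
      have h1 : q.coeff 1 = q.derivative.coeff 0 := by simp [Polynomial.coeff_derivative]
      rw [h1, Polynomial.coeff_zero_eq_eval_zero]
      simp only [q, Polynomial.derivative_mul, Polynomial.derivative_pow]
      simp
      left
      ring
    rw [← hq]
    refine Polynomial.coeff_one_le_of_eval_le (by simp [q, hp0]) fun t ht => ?_
    rw [← hpe t ht]
    simpa [q] using measureReal_add_smul_neg_le hK hKc hne ht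
  · rw [← hpe 1 zero_le_one, one_smul, ← sub_eq_add_neg]
    exact measureReal_sub_self_le hK hKc hKi hd

theorem measureReal_add_smul_neg_le_sum_choose_sq
    (hd : Module.finrank ℝ E = 4 ∨ Module.finrank ℝ E = 5) {K : Set E} (hK : IsCompact K)
    (hKc : Convex ℝ K) (hKi : (interior K).Nonempty) {t : ℝ} (ht : 0 ≤ t) :
    μ.real (K + t • (-K)) ≤ (∑ j ∈ Finset.range (Module.finrank ℝ E + 1),
      ((Module.finrank ℝ E).choose j : ℝ) ^ 2 * t ^ j) * μ.real K := by
  obtain ⟨p, hp, hpe, hpal, h0, h1, hRS⟩ :=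
    exists_palindromic_polynomial_measureReal (μ := μ) hK hKc hKi (by omega)
  rw [hpe t ht]
  rw [Polynomial.eval_eq_sum_range' (Nat.lt_succ_of_le hp)] at hRS ⊢
  rcases hd with hd | hd <;> simp only [hd] at hpal h1 hRS ⊢
  · have e3 := hpal 3 (by norm_num)
    have e4 := hpal 4 (by norm_num)
    norm_num [Finset.sum_range_succ, Nat.choose, Nat.centralBinom] at hRS h1 e3 e4 ⊢
    rw [e3, e4, h0] at hRS ⊢
    -- With `v = μ.real K`, `p = v(1 + t⁴) + a t(t - 1)² + (p(1) - 2v) t²`.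
    nlinarith [mul_nonneg (sub_nonneg.2 h1) (mul_nonneg ht (sq_nonneg (t - 1))),
      mul_nonneg (sub_nonneg.2 hRS) (sq_nonneg t)]
  · have e3 := hpal 3 (by norm_num)
    have e4 := hpal 4 (by norm_num)
    have e5 := hpal 5 (by norm_num)
    norm_num [Finset.sum_range_succ, Nat.choose, Nat.centralBinom] at hRS h1 e3 e4 e5 ⊢
    rw [e3, e4, e5, h0] at hRS ⊢
    -- Here `p = v(1 + t⁵) + a t(t + 1)(t - 1)² + (p(1)/2 - v) t²(t + 1)`, again with `v = μ.real
    -- K`.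
    nlinarith [mul_nonneg (sub_nonneg.2 h1)
        (mul_nonneg (mul_nonneg ht (by linarith : 0 ≤ t + 1)) (sq_nonneg (t - 1))),
      mul_nonneg (sub_nonneg.2 hRS) (mul_nonneg (sq_nonneg t) (by linarith : 0 ≤ t + 1))]

end DifferenceBodyBound

/-! ### Volume of the cross-simplex. -/

section CrossSimplex

/-- The difference `s S - t S` of multiples of the standard simplex `S` in `ℝⁿ`, described by the
positive and negative parts of its points. -/
def crossSimplex (n : ℕ) (s t : ℝ) : Set (Fin n → ℝ) :=
  {x | ∑ i, max (x i) 0 ≤ s ∧ ∑ i, max (-x i) 0 ≤ t}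

/-- The volume of `crossSimplex n s t`. -/
noncomputable def crossVolume (n : ℕ) (s t : ℝ) : ℝ :=
  ∑ ij ∈ Finset.HasAntidiagonal.antidiagonal n,
    (n.choose ij.1 : ℝ) * (s ^ ij.1 / ij.1.factorial * (t ^ ij.2 / ij.2.factorial))

lemma isClosed_crossSimplex (n : ℕ) (s t : ℝ) : IsClosed (crossSimplex n s t) := by
  have h1 : IsClosed {x : Fin n → ℝ | ∑ i, max (x i) 0 ≤ s} :=
    isClosed_le (by fun_prop) (by fun_prop)
  have h2 : IsClosed {x : Fin n → ℝ | ∑ i, max (-x i) 0 ≤ t} :=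
    isClosed_le (by fun_prop) (by fun_prop)
  exact h1.inter h2

lemma crossVolume_nonneg (n : ℕ) {s t : ℝ} (hs : 0 ≤ s) (ht : 0 ≤ t) : 0 ≤ crossVolume n s t :=
  Finset.sum_nonneg fun _ _ => by positivity

lemma continuous_crossVolume (n : ℕ) : Continuous fun p : ℝ × ℝ => crossVolume n p.1 p.2 := by
  unfold crossVolume
  fun_prop

lemma integral_pow_div_factorial (k : ℕ) (a : ℝ) :
    ∫ r in (0 : ℝ)..a, r ^ k / k.factorial = a ^ (k + 1) / (k + 1).factorial := by
  rw [intervalIntegral.integral_div, integral_pow, Nat.factorial_succ]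
  have := Nat.factorial_ne_zero k
  push_cast
  field_simp
  simp

/-- Pascal's rule. The two integrals correspond to the sign of a new coordinate: negative values use
up `t`, positive ones `s`. -/
lemma crossVolume_succ (n : ℕ) (s t : ℝ) :
    crossVolume (n + 1) s t =
      (∫ r in (0 : ℝ)..t, crossVolume n s r) + ∫ r in (0 : ℝ)..s, crossVolume n r t := by
  unfold crossVolume
  rw [Finset.sum_antidiagonal_choose_succ_mul
    (fun i j => s ^ i / i.factorial * (t ^ j / j.factorial)),
    intervalIntegral.integral_finsetSum
      fun _ _ => Continuous.intervalIntegrable (by fun_prop) _ _,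
    intervalIntegral.integral_finsetSum
      fun _ _ => Continuous.intervalIntegrable (by fun_prop) _ _]
  congr 1
  · refine Finset.sum_congr rfl fun ij _ => ?_
    rw [intervalIntegral.integral_const_mul, intervalIntegral.integral_const_mul,
      integral_pow_div_factorial]
  · refine Finset.sum_congr rfl fun ij hij => ?_
    rw [intervalIntegral.integral_const_mul, intervalIntegral.integral_mul_const,
      integral_pow_div_factorial, Nat.choose_symm_of_eq_add (Finset.HasAntidiagonal.mem_antidiagonal.1 hij).symm]

lemma volume_crossSimplex (n : ℕ) {s t : ℝ} (hs : 0 ≤ s) (ht : 0 ≤ t) :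
    volume (crossSimplex n s t) = ENNReal.ofReal (crossVolume n s t) := by
  induction n generalizing s t with
  | zero =>
    have h : crossSimplex 0 s t = Set.univ := by
      ext x
      simp [crossSimplex, hs, ht]
    rw [h, volume_pi, Measure.pi_univ]
    simp [crossVolume]
  | succ n ih =>
    let T : Set (ℝ × (Fin n → ℝ)) :=
      {p | p.2 ∈ crossSimplex n (s - max p.1 0) (t - max (-p.1) 0)}
    have hT : MeasurableSet T := by
      have h1 : IsClosed {p : ℝ × (Fin n → ℝ) | ∑ i, max (p.2 i) 0 ≤ s - max p.1 0} :=
        isClosed_le (by fun_prop) (by fun_prop)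
      have h2 : IsClosed {p : ℝ × (Fin n → ℝ) | ∑ i, max (-p.2 i) 0 ≤ t - max (-p.1) 0} :=
        isClosed_le (by fun_prop) (by fun_prop)
      exact (h1.inter h2).measurableSet
    have hpre : crossSimplex (n + 1) s t =
        MeasurableEquiv.piFinSuccAbove (fun _ => ℝ) 0 ⁻¹' T := by
      ext x
      simp only [crossSimplex, T, Set.mem_ofPred_eq, Set.mem_preimage, Fin.sum_univ_succ,
        MeasurableEquiv.piFinSuccAbove_apply, Fin.insertNthEquiv_symm_apply, Fin.removeNth_apply,
        Fin.zero_succAbove]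
      rw [le_sub_iff_add_le', le_sub_iff_add_le']
    let g : ℝ → ℝ := fun r => crossVolume n (s - max r 0) (t - max (-r) 0)
    have hg : Continuous g := (continuous_crossVolume n).comp
      (f := fun r : ℝ => (s - max r 0, t - max (-r) 0)) (by fun_prop)
    -- Outside `[-t, s]` one of the remaining budgets is negative, so the slice is empty.
    have hslice : ∀ r, volume (Prod.mk r ⁻¹' T) =
        (Set.Icc (-t) s).indicator (fun r => ENNReal.ofReal (g r)) r := fun r => by
      have hT' : Prod.mk r ⁻¹' T = crossSimplex n (s - max r 0) (t - max (-r) 0) := rfl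
      rw [hT']
      by_cases hr : r ∈ Set.Icc (-t) s
      · rw [Set.indicator_of_mem hr, ih]
        · exact sub_nonneg.2 (max_le hr.2 hs)
        · exact sub_nonneg.2 (max_le (by linarith [hr.1]) ht)
      · rw [Set.indicator_of_notMem hr]
        convert measure_empty (μ := (volume : Measure (Fin n → ℝ)))
        refine Set.eq_empty_of_forall_notMem fun x hx => hr ⟨?_, ?_⟩
        · have := (Finset.sum_nonneg fun i _ => le_max_right (-x i) 0).trans hx.2
          linarith [le_max_left (-r) 0]
        · have := (Finset.sum_nonneg fun i _ => le_max_right (x i) 0).trans hx.1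
          linarith [le_max_left r 0]
    rw [hpre, (volume_preserving_piFinSuccAbove (fun _ => ℝ) 0).measure_preimage
      hT.nullMeasurableSet, Measure.volume_eq_prod, Measure.prod_apply hT]
    simp_rw [hslice]
    rw [lintegral_indicator measurableSet_Icc, ← ofReal_integral_eq_lintegral_ofReal
      hg.integrableOn_Icc (by
        filter_upwards [ae_restrict_mem measurableSet_Icc] with r hr
        exact crossVolume_nonneg n (sub_nonneg.2 (max_le hr.2 hs))
          (sub_nonneg.2 (max_le (by linarith [hr.1]) ht)))]
    congr 1
    rw [integral_Icc_eq_integral_Ioc, ← intervalIntegral.integral_of_le (by linarith),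
      ← intervalIntegral.integral_add_adjacent_intervals (hg.intervalIntegrable (-t) 0)
        (hg.intervalIntegrable 0 s), crossVolume_succ]
    congr 1
    · rw [intervalIntegral.integral_congr (g := fun r => crossVolume n s (t + r)) fun r hr => ?_,
        intervalIntegral.integral_comp_add_left (crossVolume n s)]
      · simp
      · rw [Set.uIcc_of_le (by linarith)] at hr
        simp [g, max_eq_right hr.2, max_eq_left (neg_nonneg.2 hr.2)]
    · rw [intervalIntegral.integral_congr (g := fun r => crossVolume n (s - r) t) fun r hr => ?_,
        intervalIntegral.integral_comp_sub_left (fun r => crossVolume n r t)]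
      · simp
      · rw [Set.uIcc_of_le hs] at hr
        simp [g, max_eq_left hr.1, max_eq_right (neg_nonpos.2 hr.1)]

lemma crossVolume_one_zero (n : ℕ) : crossVolume n 1 0 = 1 / n.factorial := by
  rw [crossVolume, Finset.sum_eq_single (n, 0)]
  · simp
  · rintro ⟨i, j⟩ hij hne
    have hj : j ≠ 0 := by
      rintro rfl
      exact hne (by simpa using hij)
    simp [hj]
  · simp

/-- The square arises because `n! / (i! j!)` is a second copy of the binomial coefficient when `i +
j = n`. -/
lemma factorial_mul_crossVolume (n : ℕ) (s t : ℝ) :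
    n.factorial * crossVolume n s t =
      ∑ ij ∈ Finset.HasAntidiagonal.antidiagonal n, (n.choose ij.1 : ℝ) ^ 2 * (s ^ ij.1 * t ^ ij.2) := by
  rw [crossVolume, Finset.mul_sum]
  refine Finset.sum_congr rfl fun ij hij => ?_
  obtain rfl := Finset.HasAntidiagonal.mem_antidiagonal.1 hij
  rw [Nat.cast_add_choose]
  have := Nat.factorial_ne_zero ij.1
  have := Nat.factorial_ne_zero ij.2
  field_simp

end CrossSimplex

/-! ### Lower bound for the volume ratio of a simplex. -/

section Simplex

variable {n : ℕ}

/-- The linear map sending the standard basis to the edges at the vertex `p 0`. -/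
noncomputable def edgeMap (p : Fin (n + 1) → EuclideanSpace ℝ (Fin n)) :
    EuclideanSpace ℝ (Fin n) →ₗ[ℝ] EuclideanSpace ℝ (Fin n) :=
  ∑ i, (EuclideanSpace.proj i : EuclideanSpace ℝ (Fin n) →L[ℝ] ℝ).toLinearMap.smulRight
    (p i.succ - p 0)

variable (p : Fin (n + 1) → EuclideanSpace ℝ (Fin n))

lemma edgeMap_apply (x : EuclideanSpace ℝ (Fin n)) :
    edgeMap p x = ∑ i, x i • (p i.succ - p 0) := by
  simp [edgeMap]

lemma add_edgeMap_mem_convexHull {x : EuclideanSpace ℝ (Fin n)} (hx : ∀ i, 0 ≤ x i)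
    (hx1 : ∑ i, x i ≤ 1) : p 0 + edgeMap p x ∈ convexHull ℝ (Set.range p) := by
  have h := (convex_convexHull ℝ (Set.range p)).sum_mem (t := Finset.univ)
    (w := Fin.cons (1 - ∑ i, x i) x.ofLp) (z := p)
    (fun i _ => by
      refine Fin.cases ?_ (fun j => ?_) i
      · simpa using hx1
      · simpa using hx j)
    (by simp [Fin.sum_univ_succ])
    (fun i _ => subset_convexHull ℝ _ (Set.mem_range_self i))
  convert h using 1
  rw [edgeMap_apply, Fin.sum_univ_succ]
  simp only [Fin.cons_zero, Fin.cons_succ, smul_sub, Finset.sum_sub_distrib, sub_smul, one_smul,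
    Finset.sum_smul]
  abel

lemma add_edgeMap_mem_smul_convexHull {s : ℝ} (hs : 0 < s) {x : EuclideanSpace ℝ (Fin n)}
    (hx : ∀ i, 0 ≤ x i) (hxs : ∑ i, x i ≤ s) :
    s • p 0 + edgeMap p x ∈ s • convexHull ℝ (Set.range p) := by
  refine ⟨_, add_edgeMap_mem_convexHull p (x := s⁻¹ • x) (fun i => ?_) ?_, ?_⟩
  · have := hx i
    simp only [PiLp.smul_apply, smul_eq_mul]
    positivity
  · simp only [PiLp.smul_apply, smul_eq_mul, ← Finset.mul_sum]
    rwa [inv_mul_le_iff₀ hs, mul_one]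
  · simp [smul_smul, hs.ne']

/-- `crossSimplex` as a subset of Euclidean space. -/
def euclideanCrossSimplex (n : ℕ) (s t : ℝ) : Set (EuclideanSpace ℝ (Fin n)) :=
  WithLp.ofLp ⁻¹' crossSimplex n s t

lemma volume_euclideanCrossSimplex (n : ℕ) {s t : ℝ} (hs : 0 ≤ s) (ht : 0 ≤ t) :
    volume (euclideanCrossSimplex n s t) = ENNReal.ofReal (crossVolume n s t) := by
  rw [euclideanCrossSimplex, (PiLp.volume_preserving_ofLp (Fin n)).measure_preimage
    (isClosed_crossSimplex n s t).measurableSet.nullMeasurableSet, volume_crossSimplex n hs ht]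

lemma mem_euclideanCrossSimplex_one_zero {x : EuclideanSpace ℝ (Fin n)} :
    x ∈ euclideanCrossSimplex n 1 0 ↔ (∀ i, 0 ≤ x i) ∧ ∑ i, x i ≤ 1 := by
  constructor
  · rintro ⟨h1, h2⟩
    refine ⟨fun i => ?_, (Finset.sum_le_sum fun i _ => le_max_left (x i) 0).trans h1⟩
    have := (Finset.single_le_sum (f := fun i => max (-x i) 0) (fun j _ => le_max_right _ _)
      (Finset.mem_univ i)).trans h2
    linarith [le_max_left (-x i) 0]
  · rintro ⟨h1, h2⟩
    refine ⟨?_, ?_⟩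
    · simpa only [max_eq_left (h1 _)] using h2
    · simp only [max_eq_right (neg_nonpos.2 (h1 _)), Finset.sum_const_zero, le_refl]

lemma convex_euclideanCrossSimplex_one_zero : Convex ℝ (euclideanCrossSimplex n 1 0) := by
  intro x hx y hy a b ha hb hab
  rw [mem_euclideanCrossSimplex_one_zero] at *
  refine ⟨fun i => ?_, ?_⟩
  · have := hx.1 i
    have := hy.1 i
    simp only [PiLp.add_apply, PiLp.smul_apply, smul_eq_mul]
    positivity
  · simp only [PiLp.add_apply, PiLp.smul_apply, smul_eq_mul, Finset.sum_add_distrib,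
      ← Finset.mul_sum]
    nlinarith [mul_le_mul_of_nonneg_left hx.2 ha, mul_le_mul_of_nonneg_left hy.2 hb]

lemma convexHull_range_eq_vadd_image :
    convexHull ℝ (Set.range p) = p 0 +ᵥ edgeMap p '' euclideanCrossSimplex n 1 0 := by
  refine subset_antisymm (convexHull_min ?_ ?_) ?_
  · rintro _ ⟨i, rfl⟩
    refine Fin.cases ?_ (fun j => ?_) i
    · exact ⟨0, ⟨0, by simp [mem_euclideanCrossSimplex_one_zero], map_zero _⟩, by simp⟩
    · refine ⟨_, ⟨EuclideanSpace.single j 1, ?_, rfl⟩, ?_⟩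
      · rw [mem_euclideanCrossSimplex_one_zero]
        refine ⟨fun i => ?_, by simp⟩
        simp only [PiLp.single_apply]
        split_ifs <;> norm_num
      · simp [edgeMap_apply, ite_smul]
  · exact (convex_euclideanCrossSimplex_one_zero.linear_image _).vadd _
  · rintro _ ⟨_, ⟨x, hx, rfl⟩, rfl⟩
    rw [mem_euclideanCrossSimplex_one_zero] at hx
    exact add_edgeMap_mem_convexHull p hx.1 hx.2

/-- Split `x` into positive and negative parts. This inclusion alone suffices, since the simplex
ratio is needed only from below. -/
lemma vadd_image_subset_smul_add_smul_neg {s t : ℝ} (hs : 0 < s) (ht : 0 < t) :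
    (s - t) • p 0 +ᵥ edgeMap p '' euclideanCrossSimplex n s t ⊆
      s • convexHull ℝ (Set.range p) + t • (-convexHull ℝ (Set.range p)) := by
  rintro _ ⟨_, ⟨x, ⟨hxs, hxt⟩, rfl⟩, rfl⟩
  have h1 := add_edgeMap_mem_smul_convexHull p hs (x := WithLp.toLp 2 fun i => max (x i) 0)
    (fun i => le_max_right _ _) hxs
  have h2 := add_edgeMap_mem_smul_convexHull p ht (x := WithLp.toLp 2 fun i => max (-x i) 0)
    (fun i => le_max_right _ _) hxt
  rw [Set.smul_set_neg]
  refine ⟨_, h1, _, Set.neg_mem_neg.2 h2, ?_⟩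
  have hx : x = (WithLp.toLp 2 fun i => max (x i) 0) - WithLp.toLp 2 fun i => max (-x i) 0 := by
    ext i
    rcases le_total 0 (x i) with h | h <;> simp [h]
  conv_rhs => rw [hx]
  simp only [vadd_eq_add, map_sub, sub_smul]
  abel

lemma measureReal_vadd_image_euclideanCrossSimplex (c : EuclideanSpace ℝ (Fin n)) {s t : ℝ}
    (hs : 0 ≤ s) (ht : 0 ≤ t) :
    volume.real (c +ᵥ edgeMap p '' euclideanCrossSimplex n s t) =
      |LinearMap.det (edgeMap p)| * crossVolume n s t := by
  rw [measureReal_def, measure_vadd, Measure.addHaar_image_linearMap,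
    volume_euclideanCrossSimplex n hs ht, ENNReal.toReal_mul,
    ENNReal.toReal_ofReal (abs_nonneg _), ENNReal.toReal_ofReal (crossVolume_nonneg n hs ht)]

theorem sum_choose_sq_le_measureReal_simplex (Δ : Affine.Simplex ℝ (EuclideanSpace ℝ (Fin n)) n)
    {s t : ℝ} (hs : 0 < s) (ht : 0 < t) :
    ∑ ij ∈ Finset.HasAntidiagonal.antidiagonal n,
        (n.choose ij.1 : ℝ) ^ 2 * (s ^ ij.1 * t ^ ij.2) ≤
      volume.real (s • convexHull ℝ (Set.range Δ.points) +
        t • (-convexHull ℝ (Set.range Δ.points))) /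
          volume.real (convexHull ℝ (Set.range Δ.points)) := by
  set C := convexHull ℝ (Set.range Δ.points)
  have hC : IsCompact C := (Set.finite_range _).isCompact_convexHull ℝ
  have hint : (interior C).Nonempty := by
    rw [interior_convexHull_nonempty_iff_affineSpan_eq_top,
      Δ.independent.affineSpan_eq_top_iff_card_eq_finrank_add_one]
    simp
  have hpos : 0 < volume.real C := ENNReal.toReal_pos
    ((isOpen_interior.measure_pos volume hint).trans_le (measure_mono interior_subset)).ne'
    hC.measure_lt_top.ne
  have hvol : volume.real C = |LinearMap.det (edgeMap Δ.points)| * (1 / n.factorial) := by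
    rw [← crossVolume_one_zero, ← measureReal_vadd_image_euclideanCrossSimplex Δ.points
      (Δ.points 0) zero_le_one le_rfl, ← convexHull_range_eq_vadd_image]
  rw [le_div_iff₀ hpos, ← factorial_mul_crossVolume, hvol]
  have hmono := measureReal_mono (μ := volume)
    (vadd_image_subset_smul_add_smul_neg Δ.points hs ht)
    ((hC.smul s).add (hC.neg.smul t)).measure_lt_top.ne
  rw [measureReal_vadd_image_euclideanCrossSimplex _ _ hs.le ht.le] at hmono
  refine le_trans (le_of_eq ?_) hmono
  have := Nat.factorial_ne_zero n
  field_simp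

end Simplex

/-- `K` ranges over compact convex sets with non-empty interior in `ℝⁿ`, and the `n`-simplex `Δ`
is the convex hull of its `n + 1` affinely independent vertices. -/
theorem mainTheorem4 (n : ℕ) (hn : n = 4 ∨ n = 5)
    (K : ConvexBody (EuclideanSpace ℝ (Fin n)))
    (hK : (interior (K : Set (EuclideanSpace ℝ (Fin n)))).Nonempty)
    (Δ : Affine.Simplex ℝ (EuclideanSpace ℝ (Fin n)) n)
    (t : ℝ) (ht : t ∈ Set.Ioo (0 : ℝ) 1) :
    volume.real (unbalancedDifferenceBody t (K : Set (EuclideanSpace ℝ (Fin n))))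
        / volume.real (K : Set (EuclideanSpace ℝ (Fin n)))
      ≤ volume.real (unbalancedDifferenceBody t (convexHull ℝ (Set.range Δ.points)))
        / volume.real (convexHull ℝ (Set.range Δ.points)) := by
  have hs : 0 < 1 - t := sub_pos.2 ht.2
  have hpos : 0 < volume.real (K : Set (EuclideanSpace ℝ (Fin n))) := ENNReal.toReal_pos
    ((isOpen_interior.measure_pos volume hK).trans_le (measure_mono interior_subset)).ne'
    K.isCompact.measure_lt_top.ne
  refine le_trans ?_ (sum_choose_sq_le_measureReal_simplex Δ hs ht.1)
  rw [div_le_iff₀ hpos]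
  have hbound := measureReal_add_smul_neg_le_sum_choose_sq (μ := volume) (by simpa using hn)
    K.isCompact K.convex hK (div_nonneg ht.1.le hs.le)
  -- Normalises the first coefficient to `1`; the factor `(1 - t) ^ n` then homogenises the bound in
  -- `t / (1 - t)`.
  have hbody : unbalancedDifferenceBody t (K : Set (EuclideanSpace ℝ (Fin n))) =
      (1 - t) • ((K : Set (EuclideanSpace ℝ (Fin n))) + (t / (1 - t)) • (-K)) := by
    rw [unbalancedDifferenceBody, smul_add, smul_smul, mul_div_cancel₀ _ hs.ne']
  rw [finrank_euclideanSpace_fin] at hbound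
  rw [hbody, measureReal_def, Measure.addHaar_smul, finrank_euclideanSpace_fin,
    ENNReal.toReal_mul, ENNReal.toReal_ofReal (abs_nonneg _), abs_of_pos (pow_pos hs n),
    ← measureReal_def]
  refine (mul_le_mul_of_nonneg_left hbound (pow_pos hs n).le).trans (le_of_eq ?_)
  rw [← mul_assoc, Finset.mul_sum, ← Finset.Nat.sum_antidiagonal_swap,
    Finset.Nat.sum_antidiagonal_eq_sum_range_succ_mk]
  congr 1
  refine Finset.sum_congr rfl fun j hj => ?_
  have hj' : j ≤ n := Nat.lt_succ_iff.1 (Finset.mem_range.1 hj)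
  have hpow : (1 - t) ^ n = (1 - t) ^ (n - j) * (1 - t) ^ j := by
    rw [← pow_add, Nat.sub_add_cancel hj']
  simp only [Prod.fst_swap, Prod.snd_swap]
  rw [Nat.choose_symm hj', div_pow, hpow]
  field_simp
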